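/- Let $\mathbb{F}_q$ be a finite field with algebraic closure $k=\overline{\mathbb{F}}_q$, let $n\ge 1$, and let $\mathcal X\subset\mathbb{P}^n(k)$ be an irreducible projective curve defined over $\mathbb{F}_q$ and not contained in a hyperplane, with coordinate functions $x_0,\dots,x_n$ (normalised by $x_0=1$). Let $\varepsilon_0<\dots<\varepsilon_n$ be its order sequence: at all but finitely many points $P\in\mathcal X$, which are nonsingular, the intersection multiplicities at $P$ of $\mathcal X$ with the hyperplanes of $\mathbb{P}^n(k)$ are exactly $\varepsilon_0,\dots,\varepsilon_n$. Let $\mathcal X^\circ$ be the set of the nonsingular points with this property. For $P\in\mathcal X^\circ$ let $H_P$ be the osculating hyperplane, i.e. the unique hyperplane which meets $\mathcal X$ at $P$ with multiplicity $\varepsilon_n$, and let $\gamma:\mathcal X^\circ\to(\mathbb{P}^n(k))'$, $P\mapsto H_P$, be the strict Gauss map. Denote by $\mathcal X'$ the closure of its image and by $\deg_s\gamma$ the separable degree of the extension $k(\mathcal X)/\gamma^*k(\mathcal X')$. Let $(\nu_0,\dots,\nu_{n-1})$ be the $\mathbb{F}_q$-Frobenius order sequence of $\mathcal X$, i.e.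 the lexicographically least sequence of non-negative integers for which the determinant with rows $(x_0^q,\dots,x_n^q)$ and $(D_t^{(\nu_r)}x_0,\dots,D_t^{(\nu_r)}x_n)$, $r=0,\dots,n-1$, is nonzero, where $D_t^{(m)}$ denotes the $m$-th Hasse derivative with respect to a separating element $t$ of $k(\mathcal X)$. Suppose that $\mathcal X$ is $\mathbb{F}_q$-Frobenius nonclassical, that is, $(\nu_0,\dots,\nu_{n-1})\ne(0,1,\dots,n-1)$, that $\nu_{n-1}=\varepsilon_n$, and that $\deg_s\gamma\ge n$. Then for all but finitely many $P\in\mathcal X^\circ$ the fibre $\gamma^{-1}(\gamma(P))$ is contained in a linear subspace of $\mathbb{P}^n(k)$ of dimension $n-2$. -/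

import Mathlib

open scoped IntermediateField LinearAlgebra.Projectivization

theorem existsUnique_lift_of_separable {E K S : Type*} [Field E] [Field K] [Algebra E K]
    [Algebra.IsSeparable E K] [CommRing S] [Algebra E S] (π : S →ₐ[E] K)
    (hπ : Function.Surjective π) [IsAdicComplete (RingHom.ker π) S] :
    ∃! τ : K →ₐ[E] S, ∀ x, π (τ x) = x := by
  have : Algebra.FormallyEtale E K := Algebra.FormallyEtale.of_isSeparable E K
  obtain ⟨g, hg⟩ := Algebra.FormallySmooth.exists_mkₐ_comp_eq_of_isAdicComplete
    (I := RingHom.ker π) (Ideal.quotientKerAlgEquivOfSurjective hπ).symm.toAlgHom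
  have hg' : ∀ x, π (g x) = x := by
    intro x
    have h := congrArg (Ideal.quotientKerAlgEquivOfSurjective hπ) (DFunLike.congr_fun hg x)
    simpa using h
  refine ⟨g, hg', fun h hh => ?_⟩
  refine Algebra.FormallyUnramified.ext_of_iInf (I := RingHom.ker π) (R := E) ?_ ?_
  · have : IsHausdorff (RingHom.ker π) S := inferInstance
    simpa using this.iInf_pow_smul
  · intro x
    rw [Ideal.Quotient.eq, RingHom.mem_ker, map_sub, hg', hh, sub_self]

/-- `t` is a separating element of the extension `K / k`: `t` is transcendental over `k` and `K` is
separable algebraic over `k(t)`. -/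
def IsSeparatingElement (k : Type*) {K : Type*} [Field k] [Field K] [Algebra k K] (t : K) : Prop :=
  Transcendental k t ∧ Algebra.IsSeparable k⟮t⟯ K

/-- For a separating element `t` there is exactly one `k`-algebra homomorphism `τ : K → K⟦T⟧` with
`τ f ≡ f mod T` and `τ t = t + T`. -/
theorem IsSeparatingElement.existsUnique_taylor {k K : Type*} [Field k] [Field K] [Algebra k K]
    {t : K} (ht : IsSeparatingElement k t) :
    ∃! τ : K →ₐ[k] PowerSeries K, (∀ f, PowerSeries.constantCoeff (τ f) = f) ∧
      τ t = PowerSeries.C t + PowerSeries.X := by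
  obtain ⟨htr, hsep⟩ := ht
  let s : PowerSeries K := PowerSeries.C t + PowerSeries.X
  let cc : PowerSeries K →ₐ[k] K :=
    { PowerSeries.constantCoeff (R := K) with
      commutes' := fun r => by simp [PowerSeries.algebraMap_apply] }
  have hcc : ∀ f, cc f = PowerSeries.constantCoeff f := fun _ => rfl
  have hs : cc s = t := by simp [s, hcc]
  have hunit : ∀ y : nonZeroDivisors (Polynomial k),
      IsUnit ((Polynomial.aeval s : Polynomial k →ₐ[k] PowerSeries K) y) := by
    intro y
    rw [PowerSeries.isUnit_iff_constantCoeff, ← hcc, ← Polynomial.aeval_algHom_apply, hs,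
      isUnit_iff_ne_zero]
    exact fun h => nonZeroDivisors.ne_zero y.2 (transcendental_iff.mp htr _ h)
  let σ₀ : RatFunc k →ₐ[k] PowerSeries K :=
    IsLocalization.liftAlgHom (M := nonZeroDivisors (Polynomial k))
      (f := (Polynomial.aeval s : Polynomial k →ₐ[k] PowerSeries K)) hunit
  let e := RatFunc.algEquivOfTranscendental t htr
  let σ : k⟮t⟯ →ₐ[k] PowerSeries K := σ₀.comp e.symm.toAlgHom
  have he : e (algebraMap (Polynomial k) (RatFunc k) Polynomial.X)
      = IntermediateField.AdjoinSimple.gen k t := by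
    ext
    simp [e]
  have hσt : σ (IntermediateField.AdjoinSimple.gen k t) = s := by
    have : e.symm (IntermediateField.AdjoinSimple.gen k t) =
      (algebraMap (Polynomial k) (RatFunc k) Polynomial.X) := by rw [← he]; simp
    have h2 : σ (IntermediateField.AdjoinSimple.gen k t) =
        σ₀ (e.symm (IntermediateField.AdjoinSimple.gen k t)) := rfl
    rw [h2, this]
    simp only [σ₀, IsLocalization.coe_liftAlgHom, IsLocalization.lift_eq]
    simp
  have hσ : ∀ a : k⟮t⟯, cc (σ a) = a := by
    have : cc.comp σ = IntermediateField.val _ := by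
      refine IntermediateField.adjoin_algHom_ext k ?_
      intro x hx
      obtain rfl : x = t := hx
      exact (congrArg cc hσt).trans hs
    exact fun a => DFunLike.congr_fun this a
  let : SMul k⟮t⟯ (PowerSeries K) := σ.toRingHom.toAlgebra.toSMul
  let inst : Algebra k⟮t⟯ (PowerSeries K) := σ.toRingHom.toAlgebra
  let π : PowerSeries K →ₐ[k⟮t⟯] K := { cc with commutes' := fun a => hσ a }
  have hker : RingHom.ker π = Ideal.span {PowerSeries.X} := by
    ext f
    rw [RingHom.mem_ker, Ideal.mem_span_singleton, PowerSeries.X_dvd_iff]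
    rfl
  have : IsAdicComplete (RingHom.ker π) (PowerSeries K) := by rw [hker]; infer_instance
  obtain ⟨τ, hτ, huniq⟩ := existsUnique_lift_of_separable π
    (fun x => ⟨PowerSeries.C x, by change PowerSeries.constantCoeff _ = _; simp⟩)
  have hc : ∀ a : k⟮t⟯, τ a = σ a := fun a => τ.commutes a
  refine ⟨⟨τ.toRingHom, fun r => ?_⟩, ⟨hτ, ?_⟩, ?_⟩
  · exact (hc (algebraMap k k⟮t⟯ r)).trans (σ.commutes r)
  · exact (hc (IntermediateField.AdjoinSimple.gen k t)).trans hσt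
  · rintro ρ ⟨hρ, hρt⟩
    have hρσ : ρ.comp (IntermediateField.val k⟮t⟯) = σ := by
      refine IntermediateField.adjoin_algHom_ext k ?_
      intro x hx
      obtain rfl : x = t := hx
      exact hρt.trans hσt.symm
    have h := huniq ⟨ρ.toRingHom, fun a => DFunLike.congr_fun hρσ a⟩ hρ
    ext1 x
    exact DFunLike.congr_fun h x

/-- The Taylor homomorphism `f ↦ ∑ₘ D_t^{(m)}(f) T^m` attached to a separating element `t`: the unique
`k`-algebra homomorphism `τ : K → K⟦T⟧` with `τ f ≡ f mod T` and `τ t = t + T`. -/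
noncomputable def taylorHom {k K : Type*} [Field k] [Field K] [Algebra k K] {t : K}
    (ht : IsSeparatingElement k t) : K →ₐ[k] PowerSeries K :=
  ht.existsUnique_taylor.choose

/-- The `m`-th Hasse derivative `D_t^{(m)} f` of `f` with respect to the separating element `t`. -/
noncomputable def hasseDerivative {k K : Type*} [Field k] [Field K] [Algebra k K] {t : K}
    (ht : IsSeparatingElement k t) (m : ℕ) (f : K) : K :=
  PowerSeries.coeff m (taylorHom ht f)

/-- The linear form `a₀ X₀ + ⋯ + aₙ Xₙ`. -/
noncomputable def linearForm {k : Type*} [Field k] {n : ℕ} (a : Fin (n + 1) → k) :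
    MvPolynomial (Fin (n + 1)) k :=
  ∑ i, MvPolynomial.C (a i) * MvPolynomial.X i

/-- An irreducible projective curve in `ℙⁿ(k)` (with `k` algebraically closed), given by its
homogeneous prime ideal. The homogeneous coordinate ring has Krull dimension `2`, that is, the
projective variety has dimension `1`; the curve is nondegenerate, i.e. lies in no hyperplane. -/
structure ProjectiveCurve (k : Type*) [Field k] (n : ℕ) where
  ideal : Ideal (MvPolynomial (Fin (n + 1)) k)
  isPrime : ideal.IsPrime
  isHomogeneous : ∀ F ∈ ideal, ∀ d, MvPolynomial.homogeneousComponent d F ∈ ideal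
  dimension : ringKrullDim (MvPolynomial (Fin (n + 1)) k ⧸ ideal) = 2
  nondegenerate : ∀ a : Fin (n + 1) → k, linearForm a ∈ ideal → a = 0

namespace ProjectiveCurve

variable {k : Type*} [Field k] {n : ℕ} (X : ProjectiveCurve k n)

instance : X.ideal.IsPrime := X.isPrime

/-- The curve is defined over the subfield `F`: its ideal is generated by polynomials with
coefficients in `F`. -/
def IsDefinedOver (F : Type*) [Field F] [Algebra F k] : Prop :=
  (X.ideal.comap (MvPolynomial.map (algebraMap F k))).map (MvPolynomial.map (algebraMap F k))
    = X.ideal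

/-- The set of points of the curve in `ℙⁿ(k)`. -/
def points : Set (ℙ k (Fin (n + 1) → k)) :=
  {P | ∀ F ∈ X.ideal, MvPolynomial.eval P.rep F = 0}

/-- The field of fractions of the homogeneous coordinate ring. -/
def ConeField : Type _ := FractionRing (MvPolynomial (Fin (n + 1)) k ⧸ X.ideal)

noncomputable instance : Field X.ConeField :=
  inferInstanceAs (Field (FractionRing (MvPolynomial (Fin (n + 1)) k ⧸ X.ideal)))

noncomputable instance : Algebra (MvPolynomial (Fin (n + 1)) k ⧸ X.ideal) X.ConeField :=
  inferInstanceAs (Algebra _ (FractionRing (MvPolynomial (Fin (n + 1)) k ⧸ X.ideal)))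

instance : IsFractionRing (MvPolynomial (Fin (n + 1)) k ⧸ X.ideal) X.ConeField :=
  inferInstanceAs (IsFractionRing _ (FractionRing (MvPolynomial (Fin (n + 1)) k ⧸ X.ideal)))

noncomputable instance : Algebra k X.ConeField :=
  inferInstanceAs (Algebra k (FractionRing (MvPolynomial (Fin (n + 1)) k ⧸ X.ideal)))

instance : IsScalarTower k (MvPolynomial (Fin (n + 1)) k ⧸ X.ideal) X.ConeField :=
  inferInstanceAs
    (IsScalarTower k _ (FractionRing (MvPolynomial (Fin (n + 1)) k ⧸ X.ideal)))

/-- The class of a polynomial in the field of fractions of the homogeneous coordinate ring. -/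
noncomputable def cls (F : MvPolynomial (Fin (n + 1)) k) : X.ConeField :=
  algebraMap (MvPolynomial (Fin (n + 1)) k ⧸ X.ideal) X.ConeField (Ideal.Quotient.mk X.ideal F)

/-- The function field `k(X) = k(x₁/x₀, …, xₙ/x₀)` of the curve, as a subfield of `ConeField`; here
`x₀ ≠ 0` because the curve is nondegenerate. -/
noncomputable def functionSubfield : IntermediateField k X.ConeField :=
  IntermediateField.adjoin k
    (Set.range fun i => X.cls (MvPolynomial.X i) / X.cls (MvPolynomial.X 0))

/-- The function field `k(X)` of the curve. -/
def FunctionField : Type _ := X.functionSubfield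

noncomputable instance : Field X.FunctionField := inferInstanceAs (Field X.functionSubfield)

noncomputable instance : Algebra k X.FunctionField :=
  inferInstanceAs (Algebra k X.functionSubfield)

/-- The inclusion of the function field in `ConeField`. -/
noncomputable def toCone : X.FunctionField →ₐ[k] X.ConeField := X.functionSubfield.val

/-- The coordinate functions `xᵢ/x₀`; the curve is the closure of the set of its points
`(1 : x₁/x₀ : ⋯ : xₙ/x₀)`. -/
noncomputable def coord (i : Fin (n + 1)) : X.FunctionField :=
  (⟨X.cls (MvPolynomial.X i) / X.cls (MvPolynomial.X 0),
    IntermediateField.subset_adjoin _ _ ⟨i, rfl⟩⟩ : X.functionSubfield)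

/-- The rational function `f` is regular at the point `P` of the curve, with value `c`: it is a
quotient `F/G` of forms of equal degree with `G(P) ≠ 0` and `c = F(P)/G(P)`. -/
def HasValueAt (f : X.FunctionField) (P : ℙ k (Fin (n + 1) → k)) (c : k) : Prop :=
  ∃ (d : ℕ) (F G : MvPolynomial (Fin (n + 1)) k), F.IsHomogeneous d ∧ G.IsHomogeneous d ∧
    MvPolynomial.eval P.rep G ≠ 0 ∧ X.toCone f * X.cls G = X.cls F ∧
    c = MvPolynomial.eval P.rep F / MvPolynomial.eval P.rep G

/-- The subalgebra of the function field of the rational functions that are regular at `P`. -/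
noncomputable def localSubalgebra (P : ℙ k (Fin (n + 1) → k)) : Subalgebra k X.FunctionField where
  carrier := {f | ∃ c, X.HasValueAt f P c}
  mul_mem' := by
    rintro f g ⟨_, d, F, G, hF, hG, hGP, h, -⟩ ⟨_, d', F', G', hF', hG', hGP', h', -⟩
    refine ⟨_, d + d', F * F', G * G', hF.mul hF', hG.mul hG', ?_, ?_, rfl⟩
    · rw [map_mul]; exact mul_ne_zero hGP hGP'
    · simp only [cls, map_mul] at h h' ⊢
      rw [← h, ← h']; ring
  add_mem' := by
    rintro f g ⟨_, d, F, G, hF, hG, hGP, h, -⟩ ⟨_, d', F', G', hF', hG', hGP', h', -⟩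
    refine ⟨_, d + d', F * G' + G * F', G * G', (hF.mul hG').add (hG.mul hF'), hG.mul hG',
      ?_, ?_, rfl⟩
    · rw [map_mul]; exact mul_ne_zero hGP hGP'
    · simp only [cls, map_mul, map_add] at h h' ⊢
      rw [← h, ← h']; ring
  algebraMap_mem' := by
    intro r
    refine ⟨_, 0, MvPolynomial.C r, 1, MvPolynomial.isHomogeneous_C _ _,
      MvPolynomial.isHomogeneous_one _ _, by simp, ?_, rfl⟩
    rw [AlgHom.commutes]
    simp only [cls, map_one, mul_one]
    rfl

/-- The local ring of the curve at its point `P`. -/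
def LocalRing (P : ℙ k (Fin (n + 1) → k)) : Type _ := X.localSubalgebra P

noncomputable instance (P : ℙ k (Fin (n + 1) → k)) : CommRing (X.LocalRing P) :=
  inferInstanceAs (CommRing (X.localSubalgebra P))

instance (P : ℙ k (Fin (n + 1) → k)) : IsDomain (X.LocalRing P) :=
  inferInstanceAs (IsDomain (X.localSubalgebra P))

noncomputable instance (P : ℙ k (Fin (n + 1) → k)) : Algebra k (X.LocalRing P) :=
  inferInstanceAs (Algebra k (X.localSubalgebra P))

/-- The inclusion of the local ring at `P` in the function field. -/
noncomputable def toFunctionField (P : ℙ k (Fin (n + 1) → k)) :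
    X.LocalRing P →ₐ[k] X.FunctionField := (X.localSubalgebra P).val

/-- `P` is a nonsingular point of the curve: its local ring is a regular local ring of dimension
one, that is, a discrete valuation ring. -/
def IsNonsingularAt (P : ℙ k (Fin (n + 1) → k)) : Prop :=
  P ∈ X.points ∧ IsDiscreteValuationRing (X.LocalRing P)

/-- The ideal of the local ring at `P` generated by the local equation of the hyperplane `H`. Here
`H : a₀ X₀ + ⋯ + aₙ Xₙ = 0` is given by its point `(a₀ : ⋯ : aₙ)` in the dual projective space, and
local equations are `(a₀ x₀ + ⋯ + aₙ xₙ)/xⱼ` where the `j`-th coordinate of `P` is not zero. -/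
noncomputable def hyperplaneIdeal (P H : ℙ k (Fin (n + 1) → k)) : Ideal (X.LocalRing P) :=
  Ideal.span {f | ∃ j, P.rep j ≠ 0 ∧
    X.toCone (X.toFunctionField P f) * X.cls (MvPolynomial.X j)
      = X.cls (linearForm H.rep)}

/-- The intersection multiplicity of the curve and the hyperplane `H` at the point `P`: the length
of the local ring at `P` modulo the local equation of `H`. -/
noncomputable def intersectionMultiplicity (P H : ℙ k (Fin (n + 1) → k)) : ℕ∞ :=
  Module.length (X.LocalRing P) (X.LocalRing P ⧸ X.hyperplaneIdeal P H)

/-- `j₀ < ⋯ < jₙ` is the order sequence of the point `P`: these are all the intersection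
multiplicities of the curve with hyperplanes at `P`. -/
def IsOrderSequenceAt (P : ℙ k (Fin (n + 1) → k)) (j : Fin (n + 1) → ℕ) : Prop :=
  StrictMono j ∧
    Set.range (fun i => (j i : ℕ∞)) = Set.range (fun H => X.intersectionMultiplicity P H)

/-- The set `X°` of the nonsingular points of the curve whose order sequence is `ε`. -/
def genericPoints (ε : Fin (n + 1) → ℕ) : Set (ℙ k (Fin (n + 1) → k)) :=
  {P | X.IsNonsingularAt P ∧ X.IsOrderSequenceAt P ε}

/-- `ε₀ < ⋯ < εₙ` is the order sequence of the curve: it is the order sequence of all but finitely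
many of its points. -/
def IsOrderSequence (ε : Fin (n + 1) → ℕ) : Prop :=
  (X.points \ X.genericPoints ε).Finite

/-- The matrix with first row `(x₀^q, …, xₙ^q)` followed by the rows
`(D_t^{(ν r)} x₀, …, D_t^{(ν r)} xₙ)`, for `r = 0, …, n - 1`. -/
noncomputable def frobeniusMatrix {t : X.FunctionField} (ht : IsSeparatingElement k t) (q : ℕ)
    (ν : Fin n → ℕ) : Matrix (Fin (n + 1)) (Fin (n + 1)) X.FunctionField :=
  Matrix.of (Fin.cons (fun i => X.coord i ^ q)
    (fun r i => hasseDerivative ht (ν r) (X.coord i)))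

/-- `ν₀, …, νₙ₋₁` is the `𝔽_q`-Frobenius order sequence of the curve: the lexicographically least
sequence for which the determinant of `frobeniusMatrix` is nonzero (with respect to some separating
element, the choice of which does not matter). -/
def IsFrobeniusOrderSequence (q : ℕ) (ν : Fin n → ℕ) : Prop :=
  ∃ (t : X.FunctionField) (ht : IsSeparatingElement k t),
    IsLeast {μ : Lex (Fin n → ℕ) | (X.frobeniusMatrix ht q (ofLex μ)).det ≠ 0} (toLex ν)

variable {ε : Fin (n + 1) → ℕ}

theorem exists_osculatingHyperplane (P : X.genericPoints ε) :
    ∃ H, X.intersectionMultiplicity P H = ε (Fin.last n) := by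
  have h : ((ε (Fin.last n) : ℕ) : ℕ∞) ∈ Set.range (fun i => (ε i : ℕ∞)) := ⟨Fin.last n, rfl⟩
  rw [P.2.2.2] at h
  exact h

/-- The strict Gauss map `γ`. It sends `P ∈ X°` to its osculating hyperplane, which is the unique
hyperplane whose intersection multiplicity with the curve at `P` is `εₙ`, seen as a point of the dual
projective space. -/
noncomputable def gaussMap (P : X.genericPoints ε) : ℙ k (Fin (n + 1) → k) :=
  (X.exists_osculatingHyperplane P).choose

variable (ε) in
/-- The subfield `γ^*(k(X'))` of the function field, where `X'` is the strict dual curve, i.e. the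
closure of the image of `γ`. It consists of the pullbacks `f = (A/B) ∘ γ` of the quotients of forms
`A`, `B` of equal degree on the dual space with `B` not vanishing identically on `X'`. -/
noncomputable def dualFunctionField : IntermediateField k X.FunctionField :=
  IntermediateField.adjoin k {f | ∃ (d : ℕ) (A B : MvPolynomial (Fin (n + 1)) k),
    A.IsHomogeneous d ∧ B.IsHomogeneous d ∧
    ∀ᶠ P : X.genericPoints ε in Filter.cofinite,
      MvPolynomial.eval (X.gaussMap P).rep B ≠ 0 ∧
      X.HasValueAt f P
        (MvPolynomial.eval (X.gaussMap P).rep A / MvPolynomial.eval (X.gaussMap P).rep B)}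

variable (ε) in
/-- The separable degree `deg_s γ` of the Gauss map: that of the extension `k(X) / γ^*(k(X'))`. -/
noncomputable def gaussSeparableDegree : ℕ :=
  Field.finSepDegree (X.dualFunctionField ε) X.FunctionField

end ProjectiveCurve

/-! Write `Φ` for the map raising coordinates to the power `q`. The heart of the proof is that
`Φ(P)` lies on `H_P` for almost every `P` (`eventually_sum_gaussMap_mul_pow_eq_zero`). Let `a` be
the vector of cofactors along the last row of the Frobenius matrix. It annihilates `(xᵢ^q)`, and by
minimality of `ν` also the rows `D_t^{(j)} x` with `j < νₙ₋₁ = εₙ` (`exists_annihilator`). Where `t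
- t(P)` is a local parameter, vanishing of these derivatives says that the hyperplane with
coefficients `a(P)` meets the curve at `P` with multiplicity at least `εₙ`
(`mem_maximalIdeal_pow_of_hasseDerivative`). Such a hyperplane is unique, so it is `H_P`, and it
contains `Φ(P)`.

Now let `H = H_P`, and suppose every `Q` in the fibre over `H` satisfies `Φ(Q) ∈ H`; also `Q ∈ H`.
If these points spanned all of `H`, then the inverse Frobenius transform of `H`, which contains them
too, would equal `H`, so that `H` would be rational over the field with `q` elements
(`div_pow_eq_of_le_finrank_span`). There are finitely many rational hyperplanes and finitely many
points `Q` with `Φ(Q) ∉ H_Q`. Each hyperplane is `H_P` for only finitely many `P`, because `P ∈ H_P`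
and the curve lies in no hyperplane (`eventually_gaussMap_ne`). Hence for almost all `P` the fibre
spans a proper subspace of `H_P`. -/

/-! ### Forms, points and rational functions on the curve. -/

theorem MvPolynomial.IsHomogeneous.aeval_mul_left {R S σ : Type*} [CommSemiring R]
    [CommSemiring S] [Algebra R S] {F : MvPolynomial σ R} {d : ℕ} (hF : F.IsHomogeneous d)
    (c : S) (v : σ → S) :
    MvPolynomial.aeval (fun i => c * v i) F = c ^ d * MvPolynomial.aeval v F := by
  rw [MvPolynomial.aeval_def, MvPolynomial.aeval_def, MvPolynomial.eval₂_eq,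
    MvPolynomial.eval₂_eq, Finset.mul_sum]
  refine Finset.sum_congr rfl fun s hs => ?_
  have : ∑ i ∈ s.support, s i = d := by
    have := hF (MvPolynomial.mem_support_iff.mp hs)
    simpa [Finsupp.weight_apply, Finsupp.sum] using this
  simp only [mul_pow, Finset.prod_mul_distrib, Finset.prod_pow_eq_pow_sum, this]
  ring

/-- Restriction of polynomials to the line `s ↦ s • v`. -/
noncomputable def lineHom {k σ : Type*} [Field k] (v : σ → k) :
    MvPolynomial σ k →ₐ[k] Polynomial k :=
  MvPolynomial.aeval fun i => Polynomial.X * Polynomial.C (v i)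

theorem lineHom_of_isHomogeneous {k σ : Type*} [Field k] (v : σ → k) {F : MvPolynomial σ k}
    {d : ℕ} (hF : F.IsHomogeneous d) :
    lineHom v F = Polynomial.X ^ d * Polynomial.C (MvPolynomial.eval v F) := by
  rw [lineHom, hF.aeval_mul_left]
  congr 1
  exact MvPolynomial.aeval_algebraMap_apply (Polynomial k) v F

theorem eval_linearForm {k : Type*} [Field k] {n : ℕ} (a v : Fin (n + 1) → k) :
    MvPolynomial.eval v (linearForm a) = ∑ i, a i * v i := by
  simp [linearForm]

theorem isHomogeneous_linearForm {k : Type*} [Field k] {n : ℕ} (a : Fin (n + 1) → k) :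
    (linearForm a).IsHomogeneous 1 :=
  MvPolynomial.IsHomogeneous.sum _ _ _ fun i _ => by
    simpa using (MvPolynomial.isHomogeneous_C _ (a i)).mul (MvPolynomial.isHomogeneous_X k i)

theorem linearForm_single {k : Type*} [Field k] {n : ℕ} (i : Fin (n + 1)) :
    linearForm (Pi.single i (1 : k)) = MvPolynomial.X i := by
  simp [linearForm, Pi.single_apply, apply_ite MvPolynomial.C]

theorem Projectivization.eq_of_rep_eq_smul {k V : Type*} [Field k] [AddCommGroup V] [Module k V]
    {P Q : ℙ k V} {c : k} (h : Q.rep = c • P.rep) : P = Q := by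
  have hc : c ≠ 0 := by
    rintro rfl
    exact Q.rep_nonzero (by simpa using h)
  rw [← P.mk_rep, ← Q.mk_rep, Projectivization.mk_eq_mk_iff']
  exact ⟨c⁻¹, by rw [h, smul_smul, inv_mul_cancel₀ hc, one_smul]⟩

namespace ProjectiveCurve

variable {k : Type*} [Field k] {n : ℕ} (X : ProjectiveCurve k n)

/-- The kernel of `lineHom P.rep` is the homogeneous ideal of the point `P`, prime because `k[s]` is
a domain. `points` only speaks of the chosen representative; homogeneity of the curve's ideal
carries the vanishing to the whole line. -/
theorem ideal_le_ker_lineHom {P : ℙ k (Fin (n + 1) → k)} (hP : P ∈ X.points) :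
    X.ideal ≤ RingHom.ker (lineHom P.rep) := by
  intro F hF
  rw [RingHom.mem_ker, ← F.sum_homogeneousComponent, map_sum]
  refine Finset.sum_eq_zero fun d _ => ?_
  rw [lineHom_of_isHomogeneous _ (MvPolynomial.homogeneousComponent_isHomogeneous d F),
    hP _ (X.isHomogeneous F hF d), map_zero, mul_zero]

/-- A nonzero prime below the ideal of a point of the curve is that ideal, as the homogeneous
coordinate ring has dimension two. -/
theorem ker_lineHom_le {P : ℙ k (Fin (n + 1) → k)}
    {q : Ideal (MvPolynomial (Fin (n + 1)) k)} (hq : q.IsPrime) (hXq : X.ideal < q)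
    (hqP : q ≤ RingHom.ker (lineHom P.rep)) : RingHom.ker (lineHom P.rep) ≤ q := by
  by_contra hne
  have hlt : q < RingHom.ker (lineHom P.rep) := lt_of_le_not_ge hqP hne
  -- The irrelevant ideal `(X₀, …, Xₙ)`, as the kernel of evaluation at the origin. It lies strictly
  -- above the ideal of `P`, so a prime strictly between the curve and `P` would give a chain of
  -- length 3.
  let m₀ : Ideal (MvPolynomial (Fin (n + 1)) k) :=
    RingHom.ker (Polynomial.constantCoeff.comp (lineHom P.rep : _ →+* Polynomial k))
  have hlt' : RingHom.ker (lineHom P.rep) < m₀ := by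
    refine lt_of_le_not_ge (fun F hF => ?_) fun h => P.rep_nonzero ?_
    · rw [RingHom.mem_ker] at hF ⊢
      rw [RingHom.comp_apply]
      exact (congrArg _ hF).trans (map_zero _)
    · funext i
      have hX : (MvPolynomial.X i : MvPolynomial (Fin (n + 1)) k) ∈ m₀ := by
        simp [m₀, RingHom.mem_ker, lineHom]
      have := h hX
      simpa [RingHom.mem_ker, lineHom] using this
  let S : Set (PrimeSpectrum (MvPolynomial (Fin (n + 1)) k)) :=
    PrimeSpectrum.zeroLocus (X.ideal : Set (MvPolynomial (Fin (n + 1)) k))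
  let p₀ : S := ⟨⟨X.ideal, X.isPrime⟩, le_refl X.ideal⟩
  let p₁ : S := ⟨⟨q, hq⟩, hXq.le⟩
  let p₂ : S := ⟨⟨_, RingHom.ker_isPrime (lineHom P.rep)⟩, hXq.le.trans hqP⟩
  let p₃ : S := ⟨⟨m₀, RingHom.ker_isPrime _⟩, (hXq.le.trans hqP).trans hlt'.le⟩
  let c : LTSeries S :=
    { length := 3
      toFun := ![p₀, p₁, p₂, p₃]
      step := by
        intro i
        fin_cases i
        · exact hXq
        · exact hlt
        · exact hlt' }
  have h3 := Order.LTSeries.length_le_krullDim c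
  rw [← ringKrullDim_quotient, X.dimension] at h3
  exact absurd (show ((3 : ℕ) : WithBot ℕ∞) ≤ 2 from h3) (by decide)

/-- By the dimension bound, the ideal of each such zero is a minimal prime over the ideal of the
curve plus `(F)`. A Noetherian ring has finitely many of these, and a point is determined by its
ideal. -/
theorem finite_zeros {d : ℕ} {F : MvPolynomial (Fin (n + 1)) k} (hF : F.IsHomogeneous d)
    (hFX : F ∉ X.ideal) : {P | P ∈ X.points ∧ MvPolynomial.eval P.rep F = 0}.Finite := by
  refine Set.Finite.of_injOn (f := fun P => RingHom.ker (lineHom P.rep))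
    (t := (X.ideal ⊔ Ideal.span {F}).minimalPrimes) ?_ ?_
    (Ideal.finite_minimalPrimes_of_isNoetherianRing _ _)
  · rintro P ⟨hP, hFP⟩
    refine ⟨⟨RingHom.ker_isPrime _, sup_le (X.ideal_le_ker_lineHom hP) ?_⟩, ?_⟩
    · rw [Ideal.span_singleton_le_iff_mem, RingHom.mem_ker, lineHom_of_isHomogeneous _ hF, hFP,
        map_zero, mul_zero]
    · rintro q ⟨hq, hle⟩ hqP
      refine X.ker_lineHom_le hq (lt_of_le_of_ne (le_sup_left.trans hle) ?_) hqP
      rintro h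
      exact hFX (h ▸ hle (Ideal.mem_sup_right (Ideal.mem_span_singleton_self F)))
  · rintro P - Q - h
    obtain ⟨j, hj⟩ : ∃ j, P.rep j ≠ 0 := Function.ne_iff.mp P.rep_nonzero
    refine Projectivization.eq_of_rep_eq_smul (c := Q.rep j / P.rep j) ?_
    funext i
    -- These linear forms vanish at `P`; their vanishing at `Q` makes the two coordinate vectors
    -- proportional.
    have hm : MvPolynomial.C (P.rep i) * MvPolynomial.X j -
        MvPolynomial.C (P.rep j) * MvPolynomial.X i ∈ RingHom.ker (lineHom P.rep) := by
      simp only [RingHom.mem_ker, lineHom, map_sub, map_mul, MvPolynomial.aeval_X,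
        MvPolynomial.algHom_C, Polynomial.algebraMap_eq]
      ring
    have h' : RingHom.ker (lineHom P.rep) = RingHom.ker (lineHom Q.rep) := h
    rw [h', RingHom.mem_ker] at hm
    simp only [lineHom, map_sub, map_mul, MvPolynomial.aeval_X, MvPolynomial.algHom_C,
      Polynomial.algebraMap_eq] at hm
    have := congrArg (Polynomial.eval 1) hm
    simp only [Polynomial.eval_sub, Polynomial.eval_mul, Polynomial.eval_C, Polynomial.eval_X,
      one_mul, Polynomial.eval_zero] at this
    rw [Pi.smul_apply, smul_eq_mul]
    field_simp
    linear_combination -this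

theorem eventually_eval_ne_zero {d : ℕ} {F : MvPolynomial (Fin (n + 1)) k}
    (hF : F.IsHomogeneous d) (hFX : F ∉ X.ideal) :
    ∀ᶠ P : X.points in Filter.cofinite, MvPolynomial.eval P.1.rep F ≠ 0 := by
  rw [Filter.eventually_cofinite]
  refine Set.Finite.of_finite_image ((X.finite_zeros hF hFX).subset ?_)
    Subtype.val_injective.injOn
  rintro _ ⟨P, hP, rfl⟩
  exact ⟨P.2, not_not.mp hP⟩

theorem cls_eq_zero {F : MvPolynomial (Fin (n + 1)) k} : X.cls F = 0 ↔ F ∈ X.ideal := by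
  rw [cls, map_eq_zero_iff _ (IsFractionRing.injective _ _), Ideal.Quotient.eq_zero_iff_mem]

theorem cls_mul (F G : MvPolynomial (Fin (n + 1)) k) : X.cls (F * G) = X.cls F * X.cls G := by
  simp [cls]

theorem cls_add (F G : MvPolynomial (Fin (n + 1)) k) : X.cls (F + G) = X.cls F + X.cls G := by
  simp [cls]

theorem cls_pow (F : MvPolynomial (Fin (n + 1)) k) (d : ℕ) : X.cls (F ^ d) = X.cls F ^ d := by
  simp [cls]

theorem cls_one : X.cls 1 = 1 := by simp [cls]

theorem cls_C (c : k) : X.cls (MvPolynomial.C c) = algebraMap k X.ConeField c := rfl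

/-- `cls` as an algebra homomorphism. -/
noncomputable def clsHom : MvPolynomial (Fin (n + 1)) k →ₐ[k] X.ConeField where
  toRingHom := (algebraMap _ X.ConeField).comp (Ideal.Quotient.mk X.ideal)
  commutes' _ := rfl

theorem X_notMem (i : Fin (n + 1)) : MvPolynomial.X i ∉ X.ideal := by
  rw [← linearForm_single]
  intro h
  have := X.nondegenerate _ h
  simp at this

theorem cls_X_ne_zero (i : Fin (n + 1)) : X.cls (MvPolynomial.X i) ≠ 0 :=
  fun h => X.X_notMem i (X.cls_eq_zero.mp h)

theorem toCone_coord (i : Fin (n + 1)) :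
    X.toCone (X.coord i) = X.cls (MvPolynomial.X i) / X.cls (MvPolynomial.X 0) := rfl

theorem toCone_injective : Function.Injective X.toCone := X.toCone.injective

theorem toCone_aeval_coord {d : ℕ} {F : MvPolynomial (Fin (n + 1)) k} (hF : F.IsHomogeneous d) :
    X.toCone (MvPolynomial.aeval X.coord F) * X.cls (MvPolynomial.X 0) ^ d = X.cls F := by
  have h0 := X.cls_X_ne_zero 0
  rw [MvPolynomial.comp_aeval_apply, mul_comm, ← hF.aeval_mul_left]
  have : (fun i => X.cls (MvPolynomial.X 0) * X.toCone (X.coord i))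
      = fun i => X.clsHom (MvPolynomial.X i) := by
    funext i
    rw [toCone_coord, mul_div_cancel₀ _ h0]
    rfl
  rw [this]
  exact (DFunLike.congr_fun (MvPolynomial.aeval_unique X.clsHom) F).symm

/-- Every rational function on the curve is a quotient of forms. -/
theorem exists_forms (f : X.FunctionField) :
    ∃ (d : ℕ) (F G : MvPolynomial (Fin (n + 1)) k), F.IsHomogeneous d ∧ G.IsHomogeneous d ∧
      G ∉ X.ideal ∧ X.toCone f * X.cls G = X.cls F := by
  obtain ⟨f, hf⟩ := f
  change ∃ (d : ℕ) (F G : MvPolynomial (Fin (n + 1)) k), F.IsHomogeneous d ∧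
    G.IsHomogeneous d ∧ G ∉ X.ideal ∧ f * X.cls G = X.cls F
  induction hf using IntermediateField.adjoin_induction with
  | mem x hx =>
    obtain ⟨i, rfl⟩ := hx
    exact ⟨1, _, _, MvPolynomial.isHomogeneous_X k i, MvPolynomial.isHomogeneous_X k 0,
      X.X_notMem 0, div_mul_cancel₀ _ (X.cls_X_ne_zero 0)⟩
  | algebraMap x =>
    refine ⟨0, _, _, MvPolynomial.isHomogeneous_C _ x, MvPolynomial.isHomogeneous_one _ _,
      fun h => X.isPrime.ne_top (X.ideal.eq_top_iff_one.mpr h), ?_⟩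
    rw [cls_one, mul_one, cls_C]
  | add x y _ _ hx hy =>
    obtain ⟨d, F, G, hF, hG, hGX, h⟩ := hx
    obtain ⟨d', F', G', hF', hG', hGX', h'⟩ := hy
    refine ⟨d + d', F * G' + G * F', G * G', (hF.mul hG').add (hG.mul hF'), hG.mul hG',
      fun h => (X.isPrime.mem_or_mem h).elim hGX hGX', ?_⟩
    rw [cls_add, cls_mul, cls_mul, cls_mul, ← h, ← h']
    ring
  | mul x y _ _ hx hy =>
    obtain ⟨d, F, G, hF, hG, hGX, h⟩ := hx
    obtain ⟨d', F', G', hF', hG', hGX', h'⟩ := hy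
    refine ⟨d + d', F * F', G * G', hF.mul hF', hG.mul hG',
      fun h => (X.isPrime.mem_or_mem h).elim hGX hGX', ?_⟩
    rw [cls_mul, cls_mul, ← h, ← h']
    ring
  | inv x _ hx =>
    obtain ⟨d, F, G, hF, hG, hGX, h⟩ := hx
    by_cases hFX : F ∈ X.ideal
    -- Here `x = 0`, and `0⁻¹ = 0` is represented by the same quotient.
    · refine ⟨d, F, G, hF, hG, hGX, ?_⟩
      rw [X.cls_eq_zero.mpr hFX] at h ⊢
      rcases mul_eq_zero.mp h with h | h
      · rw [h, inv_zero, zero_mul]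
      · exact absurd (X.cls_eq_zero.mp h) hGX
    · refine ⟨d, G, F, hG, hF, hFX, ?_⟩
      have hx : x ≠ 0 := by
        rintro rfl
        rw [zero_mul] at h
        exact hFX (X.cls_eq_zero.mp h.symm)
      rw [← h, inv_mul_cancel_left₀ hx]

theorem eventually_hasValueAt (f : X.FunctionField) :
    ∀ᶠ P : X.points in Filter.cofinite, ∃ c, X.HasValueAt f P c := by
  obtain ⟨d, F, G, hF, hG, hGX, h⟩ := X.exists_forms f
  filter_upwards [X.eventually_eval_ne_zero hG hGX] with P hP
  exact ⟨_, d, F, G, hF, hG, hP, h, rfl⟩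

variable {X} {P : ℙ k (Fin (n + 1) → k)}

theorem HasValueAt.unique (hP : P ∈ X.points) {f : X.FunctionField} {c c' : k}
    (h : X.HasValueAt f P c) (h' : X.HasValueAt f P c') : c = c' := by
  obtain ⟨d, F, G, hF, hG, hGP, h, rfl⟩ := h
  obtain ⟨d', F', G', hF', hG', hGP', h', rfl⟩ := h'
  have : F * G' - F' * G ∈ X.ideal := by
    rw [← Ideal.Quotient.eq]
    apply IsFractionRing.injective _ X.ConeField
    change X.cls _ = X.cls _
    rw [cls_mul, cls_mul, ← h, ← h']
    ring
  have := hP _ this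
  rw [map_sub, map_mul, map_mul] at this
  rw [div_eq_div_iff hGP hGP']
  exact sub_eq_zero.mp this

theorem HasValueAt.mul {f g : X.FunctionField} {c c' : k}
    (h : X.HasValueAt f P c) (h' : X.HasValueAt g P c') : X.HasValueAt (f * g) P (c * c') := by
  obtain ⟨d, F, G, hF, hG, hGP, h, rfl⟩ := h
  obtain ⟨d', F', G', hF', hG', hGP', h', rfl⟩ := h'
  refine ⟨d + d', F * F', G * G', hF.mul hF', hG.mul hG', ?_, ?_, ?_⟩
  · rw [map_mul]; exact mul_ne_zero hGP hGP'
  · rw [map_mul, cls_mul, cls_mul, ← h, ← h']; ring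
  · rw [map_mul, map_mul, div_mul_div_comm]

theorem HasValueAt.add {f g : X.FunctionField} {c c' : k}
    (h : X.HasValueAt f P c) (h' : X.HasValueAt g P c') : X.HasValueAt (f + g) P (c + c') := by
  obtain ⟨d, F, G, hF, hG, hGP, h, rfl⟩ := h
  obtain ⟨d', F', G', hF', hG', hGP', h', rfl⟩ := h'
  refine ⟨d + d', F * G' + G * F', G * G', (hF.mul hG').add (hG.mul hF'), hG.mul hG', ?_, ?_, ?_⟩
  · rw [map_mul]; exact mul_ne_zero hGP hGP'
  · rw [map_add, cls_add, cls_mul, cls_mul, cls_mul, ← h, ← h']; ring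
  · rw [map_add, map_mul, map_mul, map_mul, div_add_div _ _ hGP hGP']

theorem hasValueAt_algebraMap (P : ℙ k (Fin (n + 1) → k)) (c : k) :
    X.HasValueAt (algebraMap k X.FunctionField c) P c := by
  refine ⟨0, MvPolynomial.C c, 1, MvPolynomial.isHomogeneous_C _ _,
    MvPolynomial.isHomogeneous_one _ _, by simp, ?_, by simp⟩
  rw [AlgHom.commutes, cls_one, mul_one, cls_C]

theorem HasValueAt.inv {f : X.FunctionField} {c : k} (h : X.HasValueAt f P c) (hc : c ≠ 0)
    (hf : f ≠ 0) : X.HasValueAt f⁻¹ P c⁻¹ := by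
  obtain ⟨d, F, G, hF, hG, hGP, h, rfl⟩ := h
  refine ⟨d, G, F, hG, hF, (div_ne_zero_iff.mp hc).1, ?_, by rw [inv_div]⟩
  rw [map_inv₀, ← h, inv_mul_cancel_left₀]
  rwa [Ne, map_eq_zero_iff _ X.toCone_injective]

theorem hasValueAt_coord (h0 : P.rep 0 ≠ 0) (i : Fin (n + 1)) :
    X.HasValueAt (X.coord i) P (P.rep i / P.rep 0) :=
  ⟨1, MvPolynomial.X i, MvPolynomial.X 0, MvPolynomial.isHomogeneous_X k i,
    MvPolynomial.isHomogeneous_X k 0, by simpa using h0,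
    div_mul_cancel₀ _ (X.cls_X_ne_zero 0), by simp⟩

theorem toFunctionField_injective : Function.Injective (X.toFunctionField P) :=
  Subtype.val_injective

theorem exists_hasValueAt (f : X.LocalRing P) : ∃ c, X.HasValueAt (X.toFunctionField P f) P c :=
  f.2

theorem HasValueAt.exists_toFunctionField_eq {f : X.FunctionField} {c : k}
    (h : X.HasValueAt f P c) : ∃ g : X.LocalRing P, X.toFunctionField P g = f :=
  ⟨⟨f, c, h⟩, rfl⟩

/-- The evaluation homomorphism from the local ring at a point of the curve to `k`. -/
noncomputable def evalAt (hP : P ∈ X.points) : X.LocalRing P →ₐ[k] k where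
  toFun f := (exists_hasValueAt f).choose
  map_one' := (exists_hasValueAt 1).choose_spec.unique hP
    (by simpa using hasValueAt_algebraMap (X := X) P 1)
  map_zero' := (exists_hasValueAt 0).choose_spec.unique hP
    (by simpa using hasValueAt_algebraMap (X := X) P 0)
  map_mul' f g := (exists_hasValueAt (f * g)).choose_spec.unique hP
    (by simpa using (exists_hasValueAt f).choose_spec.mul (exists_hasValueAt g).choose_spec)
  map_add' f g := (exists_hasValueAt (f + g)).choose_spec.unique hP
    (by simpa using (exists_hasValueAt f).choose_spec.add (exists_hasValueAt g).choose_spec)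
  commutes' c := (exists_hasValueAt _).choose_spec.unique hP
    (by simpa using hasValueAt_algebraMap (X := X) P c)

theorem hasValueAt_evalAt (hP : P ∈ X.points) (f : X.LocalRing P) :
    X.HasValueAt (X.toFunctionField P f) P (evalAt hP f) :=
  (exists_hasValueAt f).choose_spec

theorem HasValueAt.evalAt_eq (hP : P ∈ X.points) {f : X.LocalRing P} {c : k}
    (h : X.HasValueAt (X.toFunctionField P f) P c) : evalAt hP f = c :=
  (hasValueAt_evalAt hP f).unique hP h

theorem isUnit_iff_evalAt_ne_zero (hP : P ∈ X.points) (f : X.LocalRing P) :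
    IsUnit f ↔ evalAt hP f ≠ 0 := by
  refine ⟨fun h => (h.map (evalAt hP)).ne_zero, fun h => ?_⟩
  have hf : X.toFunctionField P f ≠ 0 := by
    rw [Ne, map_eq_zero_iff _ toFunctionField_injective]
    rintro rfl
    exact h (map_zero _)
  obtain ⟨g, hg⟩ := ((hasValueAt_evalAt hP f).inv h hf).exists_toFunctionField_eq
  refine IsUnit.of_mul_eq_one g (toFunctionField_injective ?_)
  rw [map_mul, hg, map_one, mul_inv_cancel₀ hf]

theorem eventually_hasValueAt_ne_zero {f : X.FunctionField} (hf : f ≠ 0) :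
    ∀ᶠ P : X.points in Filter.cofinite, ∃ c, c ≠ 0 ∧ X.HasValueAt f P c := by
  filter_upwards [X.eventually_hasValueAt f, X.eventually_hasValueAt f⁻¹] with P ⟨c, hc⟩ ⟨c', hc'⟩
  refine ⟨c, ?_, hc⟩
  rintro rfl
  have h := hc.mul hc'
  rw [mul_inv_cancel₀ hf, zero_mul, ← map_one (algebraMap k _)] at h
  exact one_ne_zero ((hasValueAt_algebraMap P.1 1).unique P.2 h)

end ProjectiveCurve

/-! ### Truncated power series, discrete valuations and Hasse derivatives. -/

/-- The power series whose coefficients of degree less than `m` lie in the subalgebra `A`. -/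
def Subalgebra.truncPowerSeries {k K : Type*} [Field k] [Field K] [Algebra k K]
    (A : Subalgebra k K) (m : ℕ) : Subalgebra k (PowerSeries K) where
  carrier := {s | ∀ j < m, PowerSeries.coeff j s ∈ A}
  mul_mem' {s u} hs hu j hj := by
    rw [PowerSeries.coeff_mul]
    exact sum_mem fun p hp => mul_mem
      (hs _ (by have := Finset.HasAntidiagonal.mem_antidiagonal.mp hp; omega))
      (hu _ (by have := Finset.HasAntidiagonal.mem_antidiagonal.mp hp; omega))
  add_mem' {s u} hs hu j hj := by
    rw [map_add]
    exact add_mem (hs j hj) (hu j hj)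
  algebraMap_mem' c j _ := by
    rw [PowerSeries.algebraMap_apply, PowerSeries.coeff_C]
    split_ifs
    · exact A.algebraMap_mem c
    · exact A.zero_mem

/-- Power series division: the coefficient of degree `j` of `s * u` is `sⱼ u₀` plus terms in earlier
coefficients of `s`, so `sⱼ` is found recursively, dividing only by `u₀`. It serves to expand
quotients of regular functions. -/
theorem Subalgebra.mem_truncPowerSeries_of_mul_mem {k K : Type*} [Field k] [Field K] [Algebra k K]
    {A : Subalgebra k K} {m : ℕ} {s u : PowerSeries K} (hsu : s * u ∈ A.truncPowerSeries m)
    (hu : u ∈ A.truncPowerSeries m) (hu0 : PowerSeries.constantCoeff u ≠ 0)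
    (hinv : (PowerSeries.constantCoeff u)⁻¹ ∈ A) : s ∈ A.truncPowerSeries m := by
  intro j
  induction j using Nat.strong_induction_on with
  | _ j ih =>
    intro hj
    have h := hsu j hj
    rw [PowerSeries.coeff_mul, ← Finset.add_sum_erase _ _
      (show (j, 0) ∈ Finset.HasAntidiagonal.antidiagonal j by simp)] at h
    have hrest : ∑ p ∈ (Finset.HasAntidiagonal.antidiagonal j).erase (j, 0),
        PowerSeries.coeff p.1 s * PowerSeries.coeff p.2 u ∈ A := by
      refine sum_mem fun p hp => ?_
      obtain ⟨hne, hp⟩ := Finset.mem_erase.mp hp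
      have hsum := Finset.HasAntidiagonal.mem_antidiagonal.mp hp
      have hlt : p.1 < j := by
        refine lt_of_le_of_ne (by omega) fun he => hne ?_
        exact Prod.ext he (by dsimp only; omega)
      exact mul_mem (ih _ hlt (hlt.trans hj)) (hu _ (by omega))
    have h' := mul_mem (sub_mem h hrest) hinv
    rwa [add_sub_cancel_right, PowerSeries.coeff_zero_eq_constantCoeff_apply,
      mul_inv_cancel_right₀ hu0] at h'

theorem mem_maximalIdeal_pow_iff_of_length {R : Type*} [CommRing R] [IsDomain R]
    [IsDiscreteValuationRing R] {x : R} {r : ℕ}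
    (hx : Module.length R (R ⧸ Ideal.span {x}) = r) (s : ℕ) :
    x ∈ IsLocalRing.maximalIdeal R ^ s ↔ s ≤ r := by
  have key : ∀ {I : Ideal R} {s r : ℕ}, I ≤ IsLocalRing.maximalIdeal R ^ s →
      Module.length R (R ⧸ I) = r → s ≤ r := by
    intro I s r hle hr
    have h := Module.length_le_of_surjective (Submodule.factor hle) (Submodule.factor_surjective hle)
    rw [IsDiscreteValuationRing.length_quotient_pow_maximalIdeal, hr] at h
    exact_mod_cast h
  refine ⟨fun h => key ((Ideal.span_singleton_le_iff_mem _).mpr h) hx, fun h => ?_⟩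
  have hx0 : x ≠ 0 := by
    rintro rfl
    -- Zero lies in every power of the maximal ideal, so its quotient cannot have finite length `r`.
    have := key (s := r + 1) ((Ideal.span_singleton_le_iff_mem _).mpr (zero_mem _)) hx
    omega
  obtain ⟨ϖ, hϖ⟩ := IsDiscreteValuationRing.exists_irreducible R
  obtain ⟨r', u, rfl⟩ := IsDiscreteValuationRing.eq_unit_mul_pow_irreducible hx0 hϖ
  have hspan : Ideal.span {(u : R) * ϖ ^ r'} = IsLocalRing.maximalIdeal R ^ r' := by
    rw [hϖ.maximalIdeal_eq, Ideal.span_singleton_pow,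
      Ideal.span_singleton_mul_left_unit u.isUnit]
  rw [hspan, IsDiscreteValuationRing.length_quotient_pow_maximalIdeal] at hx
  obtain rfl : r' = r := by exact_mod_cast hx
  refine Ideal.pow_le_pow_right h ?_
  rw [← hspan]
  exact Ideal.mem_span_singleton_self _

section Taylor

variable {k K : Type*} [Field k] [Field K] [Algebra k K] {t : K} (ht : IsSeparatingElement k t)

theorem constantCoeff_taylorHom (f : K) : PowerSeries.constantCoeff (taylorHom ht f) = f :=
  ht.existsUnique_taylor.choose_spec.1.1 f

theorem taylorHom_self : taylorHom ht t = PowerSeries.C t + PowerSeries.X :=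
  ht.existsUnique_taylor.choose_spec.1.2

theorem taylorHom_sub_algebraMap (c : k) :
    taylorHom ht (t - algebraMap k K c) = PowerSeries.C (t - algebraMap k K c) + PowerSeries.X := by
  rw [map_sub, taylorHom_self, AlgHom.commutes, PowerSeries.algebraMap_apply, map_sub]
  ring

theorem hasseDerivative_zero (f : K) : hasseDerivative ht 0 f = f := by
  rw [hasseDerivative, PowerSeries.coeff_zero_eq_constantCoeff_apply, constantCoeff_taylorHom]

theorem hasseDerivative_succ_mul (c : k) (f : K) (j : ℕ) :
    hasseDerivative ht (j + 1) ((t - algebraMap k K c) * f) =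
      (t - algebraMap k K c) * hasseDerivative ht (j + 1) f + hasseDerivative ht j f := by
  rw [hasseDerivative, map_mul, taylorHom_sub_algebraMap, add_mul, map_add, PowerSeries.coeff_C_mul,
    PowerSeries.coeff_succ_X_mul]
  rfl

theorem hasseDerivative_one_sub_algebraMap (c : k) :
    hasseDerivative ht 1 (t - algebraMap k K c) = 1 := by
  rw [hasseDerivative, taylorHom_sub_algebraMap, map_add, PowerSeries.coeff_one_X,
    PowerSeries.coeff_C, if_neg one_ne_zero, zero_add]

theorem hasseDerivative_one_mul (f g : K) :
    hasseDerivative ht 1 (f * g) = f * hasseDerivative ht 1 g + hasseDerivative ht 1 f * g := by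
  rw [hasseDerivative, map_mul, PowerSeries.coeff_mul, Finset.Nat.antidiagonal_succ]
  simp [constantCoeff_taylorHom, hasseDerivative]

theorem hasseDerivative_sum_smul {ι : Type*} (s : Finset ι) (b : ι → k) (x : ι → K) (j : ℕ) :
    hasseDerivative ht j (∑ i ∈ s, b i • x i) = ∑ i ∈ s, b i • hasseDerivative ht j (x i) := by
  simp [hasseDerivative]

end Taylor

/-! ### Local parameters and orders of vanishing. -/

namespace ProjectiveCurve

variable {k : Type*} [Field k] {n : ℕ} {X : ProjectiveCurve k n} {P : ℙ k (Fin (n + 1) → k)}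

theorem HasValueAt.mem {f : X.FunctionField} {c : k} (h : X.HasValueAt f P c) :
    f ∈ X.localSubalgebra P := ⟨c, h⟩

/-- Reduces regularity of the derivatives of all regular functions at `P` to that of finitely many
functions `D_t^{(j)} xᵢ`, a condition that fails at finitely many points only. The Taylor map is
multiplicative, so polynomials in the coordinates and then their quotients inherit the property. -/
theorem hasseDerivative_mem_localSubalgebra (hP : P ∈ X.points)
    {t : X.FunctionField} (ht : IsSeparatingElement k t) {m : ℕ}
    (hD : ∀ i, ∀ j < m, hasseDerivative ht j (X.coord i) ∈ X.localSubalgebra P)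
    {f : X.FunctionField} (hf : f ∈ X.localSubalgebra P) :
    ∀ j < m, hasseDerivative ht j f ∈ X.localSubalgebra P := by
  obtain ⟨-, d, F, G, hF, hG, hGP, h, -⟩ := hf
  have hpoly : ∀ F : MvPolynomial (Fin (n + 1)) k, taylorHom ht (MvPolynomial.aeval X.coord F) ∈
      (X.localSubalgebra P).truncPowerSeries m := by
    intro F
    induction F using MvPolynomial.induction_on with
    | C a =>
      rw [MvPolynomial.algHom_C, AlgHom.commutes]
      exact Subalgebra.algebraMap_mem _ a
    | add F G hF hG => rw [map_add, map_add]; exact add_mem hF hG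
    | mul_X F i hF =>
      rw [map_mul, map_mul, MvPolynomial.aeval_X]
      exact mul_mem hF (hD i)
  have hx0 : X.cls (MvPolynomial.X 0) ^ d ≠ 0 := pow_ne_zero _ (X.cls_X_ne_zero 0)
  have hGX : X.cls G ≠ 0 := fun h => hGP (hP _ (X.cls_eq_zero.mp h))
  have hfG : f * MvPolynomial.aeval X.coord G = MvPolynomial.aeval X.coord F := by
    apply X.toCone_injective
    apply mul_right_cancel₀ hx0
    rw [map_mul, mul_assoc, X.toCone_aeval_coord hG, X.toCone_aeval_coord hF, h]
  have hG0 : MvPolynomial.aeval X.coord G ≠ 0 := by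
    intro h0
    have := X.toCone_aeval_coord hG
    rw [h0, map_zero, zero_mul] at this
    exact hGX this.symm
  have hinv : (MvPolynomial.aeval X.coord G)⁻¹ ∈ X.localSubalgebra P := by
    refine ⟨_, d, MvPolynomial.X 0 ^ d, G, ?_, hG, hGP, ?_, rfl⟩
    · simpa using (MvPolynomial.isHomogeneous_X k (0 : Fin (n + 1))).pow d
    · rw [cls_pow, ← X.toCone_aeval_coord hG, map_inv₀, inv_mul_cancel_left₀]
      rwa [Ne, map_eq_zero_iff _ X.toCone_injective]
  refine Subalgebra.mem_truncPowerSeries_of_mul_mem (u := taylorHom ht (MvPolynomial.aeval X.coord G))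
    ?_ (hpoly G) ?_ ?_
  · rw [← map_mul, hfG]
    exact hpoly F
  · rwa [constantCoeff_taylorHom]
  · rwa [constantCoeff_taylorHom]

section DVR

variable [IsDiscreteValuationRing (X.LocalRing P)]

theorem mem_maximalIdeal_iff (hP : P ∈ X.points) (f : X.LocalRing P) :
    f ∈ IsLocalRing.maximalIdeal (X.LocalRing P) ↔ evalAt hP f = 0 := by
  rw [IsLocalRing.mem_maximalIdeal, mem_nonunits_iff, isUnit_iff_evalAt_ne_zero hP, not_not]

/-- If the first Hasse derivative preserves the local ring at `P`, then `t - t(P)` is a local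
parameter at `P`. -/
theorem maximalIdeal_eq_span (hP : P ∈ X.points) {t' : X.LocalRing P}
    (ht : IsSeparatingElement k (X.toFunctionField P t'))
    (hD : ∀ f : X.LocalRing P, ∃ g, X.toFunctionField P g =
      hasseDerivative ht 1 (X.toFunctionField P f)) :
    IsLocalRing.maximalIdeal (X.LocalRing P) =
      Ideal.span {t' - algebraMap k _ (evalAt hP t')} := by
  obtain ⟨ϖ, hϖ⟩ := IsDiscreteValuationRing.exists_irreducible (X.LocalRing P)
  have hmem : t' - algebraMap k _ (evalAt hP t') ∈ IsLocalRing.maximalIdeal (X.LocalRing P) := by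
    rw [mem_maximalIdeal_iff hP, map_sub, AlgHom.commutes]
    exact sub_self _
  have hϖP : evalAt hP ϖ = 0 := by
    rw [← mem_maximalIdeal_iff hP, hϖ.maximalIdeal_eq]
    exact Ideal.mem_span_singleton_self ϖ
  rw [hϖ.maximalIdeal_eq, Ideal.mem_span_singleton] at hmem
  obtain ⟨g, hg⟩ := hmem
  obtain ⟨g', hg'⟩ := hD g
  obtain ⟨ϖ', hϖ'⟩ := hD ϖ
  -- Product rule applied to `t - t(P) = ϖ g`. At `P` the first term vanishes, so `g(P) ≠ 0`.
  have h1 : (1 : X.LocalRing P) = ϖ * g' + ϖ' * g := by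
    apply toFunctionField_injective
    rw [map_add, map_mul, map_mul, hg', hϖ', ← hasseDerivative_one_mul, ← map_mul, ← hg, map_sub,
      AlgHom.commutes, hasseDerivative_one_sub_algebraMap, map_one]
  have hgu : IsUnit g := by
    rw [isUnit_iff_evalAt_ne_zero hP]
    intro hgP
    have := congrArg (evalAt hP) h1
    simp [hgP, hϖP] at this
  rw [hg, hϖ.maximalIdeal_eq, Ideal.span_singleton_mul_right_unit hgu]

/-- Divide by the local parameter: if `f = (t - t(P)) g`, then `D^{(j+1)} f` and `D^{(j)} g` have
the same value at `P`, so `g` satisfies the hypothesis with one derivative fewer. The bound `2 ≤ M`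
makes `D^{(1)}` available, which is what shows that `t - t(P)` is a local parameter. -/
theorem mem_maximalIdeal_pow_of_hasseDerivative (hP : P ∈ X.points) {t : X.FunctionField}
    (ht : IsSeparatingElement k t) (htP : t ∈ X.localSubalgebra P) {M : ℕ} (hM : 2 ≤ M)
    (hD : ∀ f ∈ X.localSubalgebra P, ∀ j < M, hasseDerivative ht j f ∈ X.localSubalgebra P)
    {m : ℕ} (hm : m ≤ M) (f : X.LocalRing P)
    (hf : ∀ j < m, X.HasValueAt (hasseDerivative ht j (X.toFunctionField P f)) P 0) :
    f ∈ IsLocalRing.maximalIdeal (X.LocalRing P) ^ m := by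
  obtain ⟨t', rfl⟩ : ∃ t', X.toFunctionField P t' = t := ⟨⟨t, htP⟩, rfl⟩
  have hD' : ∀ f : X.LocalRing P, ∀ j < M, ∃ g, X.toFunctionField P g =
      hasseDerivative ht j (X.toFunctionField P f) :=
    fun f j hj => ⟨⟨_, hD _ f.2 j hj⟩, rfl⟩
  have hmax := maximalIdeal_eq_span hP ht fun f => hD' f 1 (by omega)
  induction m generalizing f with
  | zero => simp
  | succ m ih =>
    have hfM : f ∈ IsLocalRing.maximalIdeal (X.LocalRing P) := by
      rw [mem_maximalIdeal_iff hP]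
      have h := hf 0 (by omega)
      rw [hasseDerivative_zero] at h
      exact h.evalAt_eq hP
    rw [hmax, Ideal.mem_span_singleton] at hfM
    obtain ⟨g, rfl⟩ := hfM
    rw [pow_succ']
    refine Ideal.mul_mem_mul (hmax ▸ Ideal.mem_span_singleton_self _)
      (ih (by omega) g fun j hj => ?_)
    obtain ⟨g₀, hg₀⟩ := hD' g j (by omega)
    obtain ⟨g₁, hg₁⟩ := hD' g (j + 1) (by omega)
    have h := hf (j + 1) (by omega)
    rw [map_mul, map_sub, AlgHom.commutes, hasseDerivative_succ_mul, ← hg₀, ← hg₁,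
      ← AlgHom.commutes (X.toFunctionField P), ← map_sub, ← map_mul, ← map_add] at h
    have h' := h.evalAt_eq hP
    rw [map_add, map_mul, map_sub, AlgHom.commutes] at h'
    have h'' : evalAt hP g₀ = 0 := by simpa using h'
    rw [← hg₀, ← h'']
    exact hasValueAt_evalAt hP g₀

end DVR

/-! ### Contact of hyperplanes with the curve. -/

/-- The coordinate function `xᵢ` as an element of the local ring at a point with nonzero zeroth
coordinate. -/
noncomputable def coordGerm (h0 : P.rep 0 ≠ 0) (i : Fin (n + 1)) : X.LocalRing P :=
  (⟨X.coord i, (hasValueAt_coord h0 i).mem⟩ : X.localSubalgebra P)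

/-- The linear map sending `b` to the germ of `b₀ x₀ + ⋯ + bₙ xₙ` at a point with nonzero
zeroth coordinate. -/
noncomputable def linearGerm (h0 : P.rep 0 ≠ 0) : (Fin (n + 1) → k) →ₗ[k] X.LocalRing P :=
  Fintype.linearCombination k (coordGerm h0)

theorem toFunctionField_linearGerm (h0 : P.rep 0 ≠ 0) (b : Fin (n + 1) → k) :
    X.toFunctionField P (linearGerm h0 b) = ∑ i, b i • X.coord i := by
  rw [linearGerm, Fintype.linearCombination_apply, map_sum]
  simp only [map_smul]
  rfl

theorem toCone_linearGerm (h0 : P.rep 0 ≠ 0) (b : Fin (n + 1) → k) :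
    X.toCone (X.toFunctionField P (linearGerm h0 b)) * X.cls (MvPolynomial.X 0)
      = X.cls (linearForm b) := by
  have : MvPolynomial.aeval X.coord (linearForm b) = ∑ i, b i • X.coord i := by
    simp [linearForm, Algebra.smul_def]
  rw [toFunctionField_linearGerm, ← this, ← X.toCone_aeval_coord (isHomogeneous_linearForm b),
    pow_one]

theorem hasValueAt_linearGerm (h0 : P.rep 0 ≠ 0) (b : Fin (n + 1) → k) :
    X.HasValueAt (X.toFunctionField P (linearGerm h0 b)) P ((∑ i, b i * P.rep i) / P.rep 0) :=
  ⟨1, linearForm b, MvPolynomial.X 0, isHomogeneous_linearForm b, MvPolynomial.isHomogeneous_X k 0,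
    by simpa using h0, toCone_linearGerm h0 b, by rw [eval_linearForm, MvPolynomial.eval_X]⟩

/-- The local equations for different `j` differ by the factors `xⱼ/x₀`, which are units at `P`. -/
theorem hyperplaneIdeal_eq_span (h0 : P.rep 0 ≠ 0) (H : ℙ k (Fin (n + 1) → k)) :
    X.hyperplaneIdeal P H = Ideal.span {linearGerm h0 H.rep} := by
  apply le_antisymm
  · refine Ideal.span_le.mpr ?_
    rintro f ⟨j, hj, hf⟩
    have hu : X.coord j ≠ 0 := by
      rw [Ne, ← map_eq_zero_iff _ X.toCone_injective, toCone_coord]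
      exact div_ne_zero (X.cls_X_ne_zero j) (X.cls_X_ne_zero 0)
    obtain ⟨g, hg⟩ := ((hasValueAt_coord h0 j).inv (div_ne_zero hj h0) hu).exists_toFunctionField_eq
    refine Ideal.mem_span_singleton.mpr ⟨g, toFunctionField_injective ?_⟩
    rw [map_mul, hg, eq_mul_inv_iff_mul_eq₀ hu]
    apply X.toCone_injective
    apply mul_right_cancel₀ (X.cls_X_ne_zero 0)
    rw [toCone_linearGerm, map_mul, toCone_coord, mul_assoc, div_mul_cancel₀ _ (X.cls_X_ne_zero 0),
      hf]
  · rw [Ideal.span_singleton_le_iff_mem]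
    exact Ideal.subset_span ⟨0, h0, toCone_linearGerm h0 _⟩

section Contact

variable [IsDiscreteValuationRing (X.LocalRing P)]

/-- The hyperplanes that meet the curve at `P` with multiplicity at least `m`. -/
noncomputable def contactSubmodule (h0 : P.rep 0 ≠ 0) (m : ℕ) :
    Submodule k (Fin (n + 1) → k) :=
  ((IsLocalRing.maximalIdeal (X.LocalRing P) ^ m).restrictScalars k).comap (linearGerm h0)

theorem mem_contactSubmodule {h0 : P.rep 0 ≠ 0} {m : ℕ} {b : Fin (n + 1) → k} :
    b ∈ contactSubmodule (X := X) h0 m ↔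
      linearGerm h0 b ∈ IsLocalRing.maximalIdeal (X.LocalRing P) ^ m := Iff.rfl

theorem rep_mem_contactSubmodule_iff (h0 : P.rep 0 ≠ 0) {H : ℙ k (Fin (n + 1) → k)} {r : ℕ}
    (hH : X.intersectionMultiplicity P H = r) (m : ℕ) :
    H.rep ∈ contactSubmodule (X := X) h0 m ↔ m ≤ r := by
  rw [intersectionMultiplicity, hyperplaneIdeal_eq_span h0] at hH
  rw [mem_contactSubmodule, mem_maximalIdeal_pow_iff_of_length hH]

/-- The contact filtration drops strictly at each step: a hyperplane of multiplicity exactly `εᵢ`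
belongs to the `εᵢ`-th term and not to the next. After `n` drops from dimension `n + 1` at most a
line is left. -/
theorem finrank_contactSubmodule_add_le (h0 : P.rep 0 ≠ 0) {ε : Fin (n + 1) → ℕ}
    (hε : X.IsOrderSequenceAt P ε) (i : Fin (n + 1)) :
    Module.finrank k (contactSubmodule (X := X) h0 (ε i)) + i ≤ n + 1 := by
  induction i using Fin.induction with
  | zero =>
    have := (contactSubmodule (X := X) h0 (ε 0)).finrank_le
    rw [Module.finrank_fin_fun] at this
    simpa using this
  | succ i ih =>
    have hlt : contactSubmodule (X := X) h0 (ε i.succ) < contactSubmodule (X := X) h0 (ε i.castSucc) := by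
      obtain ⟨H, hH⟩ : ((ε i.castSucc : ℕ) : ℕ∞) ∈
          Set.range (fun H => X.intersectionMultiplicity P H) := hε.2 ▸ ⟨i.castSucc, rfl⟩
      have hε' := hε.1 (Fin.castSucc_lt_succ (i := i))
      refine lt_of_le_of_ne (fun b hb => Ideal.pow_le_pow_right hε'.le hb) fun he => ?_
      have h1 := (rep_mem_contactSubmodule_iff h0 hH (ε i.castSucc)).mpr le_rfl
      rw [← he, rep_mem_contactSubmodule_iff h0 hH] at h1
      omega
    have := Submodule.finrank_lt_finrank_of_lt hlt
    rw [Fin.val_succ]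
    rw [Fin.val_castSucc] at ih
    omega

/-- The osculating hyperplane at `P` is unique. -/
theorem finrank_contactSubmodule_last_le_one (h0 : P.rep 0 ≠ 0) {ε : Fin (n + 1) → ℕ}
    (hε : X.IsOrderSequenceAt P ε) :
    Module.finrank k (contactSubmodule (X := X) h0 (ε (Fin.last n))) ≤ 1 := by
  have := finrank_contactSubmodule_add_le h0 hε (Fin.last n)
  rw [Fin.val_last] at this
  omega

end Contact

end ProjectiveCurve

/-! ### Linear algebra and rational hyperplanes. -/

theorem Submodule.exists_smul_eq_of_finrank_le_one {k V : Type*} [Field k] [AddCommGroup V]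
    [Module k V] [FiniteDimensional k V] {W : Submodule k V} (hW : Module.finrank k W ≤ 1)
    {b v : V} (hb : b ∈ W) (hb0 : b ≠ 0) (hv : v ∈ W) : ∃ s : k, v = s • b := by
  obtain ⟨u, hu⟩ := finrank_le_one_iff.mp hW
  obtain ⟨c, hc⟩ := hu ⟨b, hb⟩
  obtain ⟨d, hd⟩ := hu ⟨v, hv⟩
  have hc' : c • (u : V) = b := congrArg Subtype.val hc
  have hd' : d • (u : V) = v := congrArg Subtype.val hd
  have hc0 : c ≠ 0 := by
    rintro rfl
    exact hb0 (by rw [← hc', zero_smul])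
  exact ⟨d / c, by rw [← hc', ← hd', smul_smul, div_mul_cancel₀ _ hc0]⟩

theorem Submodule.exists_ge_finrank_eq {k V : Type*} [Field k] [AddCommGroup V] [Module k V]
    [FiniteDimensional k V] (U : Submodule k V) {d : ℕ} (hU : Module.finrank k U ≤ d)
    (hd : d ≤ Module.finrank k V) : ∃ W, U ≤ W ∧ Module.finrank k W = d := by
  induction d, hU using Nat.le_induction with
  | base => exact ⟨U, le_rfl, rfl⟩
  | succ d _ ih =>
    obtain ⟨W, hUW, hW⟩ := ih (by omega)
    obtain ⟨v, hv⟩ := W.exists_of_finrank_lt (by omega)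
    have hvW : v ∉ W := by simpa using hv 1 one_ne_zero
    refine ⟨W ⊔ Submodule.span k {v}, hUW.trans le_sup_left, ?_⟩
    have hlt : W < W ⊔ Submodule.span k {v} :=
      lt_of_le_not_ge le_sup_left fun h =>
        hvW (h (Submodule.mem_sup_right (Submodule.mem_span_singleton_self v)))
    have h1 := Submodule.finrank_lt_finrank_of_lt hlt
    have h2 := Submodule.finrank_add_le_finrank_add_finrank W (Submodule.span k {v})
    have h3 := finrank_span_singleton (K := k) (fun h : v = 0 => hvW (h ▸ W.zero_mem))
    omega

/-- A hyperplane `b` spanned by vectors whose Frobenius images lie in it is rational. -/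
theorem div_pow_eq_of_le_finrank_span {k : Type*} [Field k] [PerfectField k] {p e : ℕ}
    [ExpChar k p] {n : ℕ} {S : Set (Fin (n + 1) → k)}
    (hS : n ≤ Module.finrank k (Submodule.span k S)) {b : Fin (n + 1) → k}
    (hb : ∀ v ∈ S, ∑ i, b i * v i = 0) (hb' : ∀ v ∈ S, ∑ i, b i * v i ^ p ^ e = 0)
    {j : Fin (n + 1)} (hj : b j ≠ 0) (i : Fin (n + 1)) : (b i / b j) ^ p ^ e = b i / b j := by
  let φ := iterateFrobeniusEquiv k p e
  have hφ : ∀ x, φ x = x ^ p ^ e := fun _ => rfl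
  have hW : Module.finrank k (Submodule.span k S).dualAnnihilator ≤ 1 := by
    have := Subspace.finrank_add_finrank_dualAnnihilator_eq (Submodule.span k S)
    rw [Module.finrank_fin_fun] at this
    omega
  have hmem : ∀ c : Fin (n + 1) → k, (∀ v ∈ S, ∑ i, c i * v i = 0) →
      dotProductEquiv k (Fin (n + 1)) c ∈ (Submodule.span k S).dualAnnihilator := by
    intro c hc
    rw [Submodule.mem_dualAnnihilator]
    exact fun w hw => Submodule.span_le (p := LinearMap.ker (dotProductEquiv k (Fin (n + 1)) c)).mpr
      (fun v hv => hc v hv) hw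
  -- Untwisting `hb'` by the inverse Frobenius gives a second linear form vanishing on `S`. The
  -- annihilator of `S` is at most a line, so this form is a multiple of `b`, and ratios of the `bᵢ`
  -- are fixed by Frobenius.
  have h2 : ∀ v ∈ S, ∑ i, φ.symm (b i) * v i = 0 := by
    intro v hv
    apply φ.injective
    rw [map_sum, map_zero, ← hb' v hv]
    refine Finset.sum_congr rfl fun i _ => ?_
    rw [map_mul, RingEquiv.apply_symm_apply, hφ]
  have hb0 : dotProductEquiv k (Fin (n + 1)) b ≠ 0 := by
    rw [Ne, LinearEquiv.map_eq_zero_iff]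
    rintro rfl
    exact hj rfl
  obtain ⟨s, hs⟩ := Submodule.exists_smul_eq_of_finrank_le_one hW (hmem b hb) hb0
    (hmem (fun i => φ.symm (b i)) h2)
  rw [← map_smul] at hs
  have hs' : ∀ i, φ.symm (b i) = s * b i := fun i =>
    congrFun ((dotProductEquiv k (Fin (n + 1))).injective hs) i
  have hs0 : s ≠ 0 := by
    rintro rfl
    have := hs' j
    rw [zero_mul, map_eq_zero_iff _ φ.symm.injective] at this
    exact hj this
  rw [← hφ]
  apply φ.symm.injective
  rw [RingEquiv.symm_apply_apply, map_div₀, hs', hs', mul_div_mul_left _ _ hs0]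

/-- After normalising one coordinate to 1, all coordinates are roots of `X^q - X`. -/
theorem finite_setOf_rational {k : Type*} [Field k] {q : ℕ} (hq : 1 < q) (n : ℕ) :
    {H : ℙ k (Fin (n + 1) → k) | ∀ j, H.rep j ≠ 0 → ∀ i,
      (H.rep i / H.rep j) ^ q = H.rep i / H.rep j}.Finite := by
  have hfix : {x : k | x ^ q = x}.Finite := by
    refine (Polynomial.finite_setOfPred_isRoot
      (FiniteField.X_pow_card_sub_X_ne_zero k hq)).subset fun x hx => ?_
    have hx : x ^ q = x := hx
    simp [Polynomial.IsRoot, hx]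
  have hj : ∀ j : Fin (n + 1), {H : ℙ k (Fin (n + 1) → k) | H.rep j ≠ 0 ∧ ∀ i,
      (H.rep i / H.rep j) ^ q = H.rep i / H.rep j}.Finite := by
    intro j
    refine Set.Finite.of_injOn (f := fun H i => H.rep i / H.rep j)
      (t := Set.pi Set.univ fun _ : Fin (n + 1) => {x : k | x ^ q = x}) ?_ ?_
      (Set.Finite.pi fun _ => hfix)
    · rintro H ⟨-, hH⟩ i -
      exact hH i
    · rintro H ⟨hH, -⟩ H' ⟨hH', -⟩ h
      refine Projectivization.eq_of_rep_eq_smul (c := H'.rep j / H.rep j) ?_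
      funext i
      have := congrFun h i
      simp only at this
      rw [Pi.smul_apply, smul_eq_mul]
      field_simp at this ⊢
      linear_combination -this
  refine (Set.finite_iUnion hj).subset fun H hH => ?_
  obtain ⟨j, hj⟩ := Function.ne_iff.mp H.rep_nonzero
  exact Set.mem_iUnion.mpr ⟨j, hj, hH j hj⟩

/-! ### Frobenius orders and the Gauss map. -/

namespace ProjectiveCurve

variable {k : Type*} [Field k] {n : ℕ} {X : ProjectiveCurve k n}

/-- By the minimality of the Frobenius orders, the rows `D_t^{(j)} x` with `j < ν r` lie in the
hyperplane spanned by the rows of `frobeniusMatrix` other than that of `D_t^{(ν r)} x`. -/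
theorem exists_annihilator {t : X.FunctionField} {ht : IsSeparatingElement k t} {q : ℕ}
    {ν : Fin n → ℕ}
    (hν : IsLeast {μ : Lex (Fin n → ℕ) | (X.frobeniusMatrix ht q (ofLex μ)).det ≠ 0} (toLex ν))
    (r : Fin n) :
    ∃ a : Fin (n + 1) → X.FunctionField, a ≠ 0 ∧ ∑ i, a i * X.coord i ^ q = 0 ∧
      ∀ j < ν r, ∑ i, a i * hasseDerivative ht j (X.coord i) = 0 := by
  classical
  let A := X.frobeniusMatrix ht q ν
  have hA : A.det ≠ 0 := hν.1
  -- Cofactor expansion: pairing the cofactors of a row with `v` gives the determinant with that row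
  -- replaced by `v`.
  have key : ∀ v : Fin (n + 1) → X.FunctionField,
      ∑ i, A.adjugate i r.succ * v i = (A.updateRow r.succ v).det := by
    intro v
    rw [← Matrix.cramer_transpose_apply, Matrix.cramer_eq_adjugate_mulVec, Matrix.mulVec,
      dotProduct, ← Matrix.adjugate_transpose]
    rfl
  refine ⟨fun i => A.adjugate i r.succ, fun h => ?_, ?_, fun j hj => ?_⟩
  · have h1 := key (A r.succ)
    rw [Matrix.updateRow_eq_self] at h1
    refine hA (h1.symm.trans (Finset.sum_eq_zero fun i _ => ?_))
    have := congrFun h i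
    simp only [Pi.zero_apply] at this
    rw [this, zero_mul]
  · rw [key]
    refine Matrix.det_zero_of_row_eq (Fin.succ_ne_zero r) ?_
    rw [Matrix.updateRow_self, Matrix.updateRow_ne (Fin.succ_ne_zero r).symm]
    rfl
  · rw [key]
    have hupd : A.updateRow r.succ (fun i => hasseDerivative ht j (X.coord i)) =
        X.frobeniusMatrix ht q (Function.update ν r j) := by
      ext l i
      refine Fin.cases ?_ (fun l => ?_) l
      · rw [Matrix.updateRow_ne (Fin.succ_ne_zero r).symm]
        rfl
      · by_cases hl : l = r
        · subst hl
          rw [Matrix.updateRow_self]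
          simp [frobeniusMatrix]
        · rw [Matrix.updateRow_ne (fun h => hl (Fin.succ_injective _ h))]
          simp [A, frobeniusMatrix, Function.update_of_ne hl]
    -- Lowering one entry of `ν` makes it lexicographically smaller, so a nonzero determinant would
    -- contradict minimality. No monotonicity of the new sequence is required.
    rw [hupd]
    by_contra hne
    have hle := hν.2 (show toLex (Function.update ν r j) ∈ _ from hne)
    exact absurd (Pi.toLex_update_lt_self_iff.mpr hj) (not_lt.mpr hle)

variable {ε : Fin (n + 1) → ℕ}

theorem intersectionMultiplicity_gaussMap (P : X.genericPoints ε) :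
    X.intersectionMultiplicity P (X.gaussMap P) = ε (Fin.last n) :=
  (X.exists_osculatingHyperplane P).choose_spec

theorem eventually_genericPoints {p : X.points → Prop} (h : ∀ᶠ P in Filter.cofinite, p P) :
    ∀ᶠ P : X.genericPoints ε in Filter.cofinite, p ⟨P, P.2.1.1⟩ :=
  (Function.Injective.tendsto_cofinite (f := fun P : X.genericPoints ε => (⟨P, P.2.1.1⟩ : X.points))
    fun _ _ h => Subtype.ext (congrArg (fun Q : X.points => Q.1) h)).eventually h

variable (X) in
theorem eventually_rep_zero_ne_zero :
    ∀ᶠ P : X.points in Filter.cofinite, P.1.rep 0 ≠ 0 := by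
  filter_upwards [X.eventually_eval_ne_zero (MvPolynomial.isHomogeneous_X k 0) (X.X_notMem 0)]
    with P hP
  simpa using hP

theorem sum_gaussMap_mul_eq_zero (hn : ε (Fin.last n) ≠ 0) (P : X.genericPoints ε)
    (h0 : P.1.rep 0 ≠ 0) : ∑ i, (X.gaussMap P).rep i * P.1.rep i = 0 := by
  have := P.2.1.2
  have h := (rep_mem_contactSubmodule_iff h0 (intersectionMultiplicity_gaussMap P) 1).mpr
    (Nat.one_le_iff_ne_zero.mpr hn)
  rw [mem_contactSubmodule, pow_one, mem_maximalIdeal_iff P.2.1.1,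
    (hasValueAt_linearGerm h0 _).evalAt_eq] at h
  exact (div_eq_zero_iff.mp h).resolve_right h0

/-- Points with osculating hyperplane `H` lie on `H`, which meets the nondegenerate curve in
finitely many points. Thus the fibres of the Gauss map are finite. -/
theorem eventually_gaussMap_ne (hn : ε (Fin.last n) ≠ 0) (H : ℙ k (Fin (n + 1) → k)) :
    ∀ᶠ P : X.genericPoints ε in Filter.cofinite, X.gaussMap P ≠ H := by
  filter_upwards [eventually_genericPoints (X.eventually_eval_ne_zero
    (isHomogeneous_linearForm H.rep) fun h => H.rep_nonzero (X.nondegenerate _ h)),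
    eventually_genericPoints X.eventually_rep_zero_ne_zero] with P hP h0
  rintro rfl
  rw [eval_linearForm] at hP
  exact hP (sum_gaussMap_mul_eq_zero hn P h0)

/-- If `ν r = εₙ` for some `r`, then the image of almost every point under the Frobenius map lies in
the osculating hyperplane. -/
theorem eventually_sum_gaussMap_mul_pow_eq_zero {q : ℕ} {ν : Fin n → ℕ}
    (hν : X.IsFrobeniusOrderSequence q ν) {r : Fin n} (hr : ν r = ε (Fin.last n)) :
    ∀ᶠ P : X.genericPoints ε in Filter.cofinite,
      ∑ i, (X.gaussMap P).rep i * P.1.rep i ^ q = 0 := by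
  obtain ⟨t, ht, hν⟩ := hν
  obtain ⟨a, ha, haq, haD⟩ := exists_annihilator hν r
  obtain ⟨i₀, hi₀⟩ := Function.ne_iff.mp ha
  -- Derivatives of order below `εₙ` measure the contact; the 2 ensures that order 1 is included
  -- even when `εₙ = 1`.
  let M := max 2 (ε (Fin.last n))
  have hreg : ∀ᶠ P : X.points in Filter.cofinite, ∀ i, ∀ j ∈ Set.Iio M,
      hasseDerivative ht j (X.coord i) ∈ X.localSubalgebra P :=
    Filter.eventually_all.mpr fun i => (Filter.eventually_all_finite (Set.finite_Iio M)).mpr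
      fun j _ => X.eventually_hasValueAt _
  filter_upwards [eventually_genericPoints X.eventually_rep_zero_ne_zero,
    eventually_genericPoints (X.eventually_hasValueAt t), eventually_genericPoints hreg,
    eventually_genericPoints (Filter.eventually_all.mpr fun i => X.eventually_hasValueAt (a i)),
    eventually_genericPoints (eventually_hasValueAt_ne_zero hi₀)] with P h0 htP hD haP hai₀
  have hP := P.2.1.1
  have := P.2.1.2
  have hreg := fun f hf => hasseDerivative_mem_localSubalgebra (f := f) hP ht hD hf
  let a' : Fin (n + 1) → X.LocalRing P := fun i => (⟨a i, haP i⟩ : X.localSubalgebra P)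
  have ha' : ∀ i, X.toFunctionField P (a' i) = a i := fun _ => rfl
  let b : Fin (n + 1) → k := fun i => evalAt hP (a' i)
  have hb0 : b ≠ 0 := by
    obtain ⟨c, hc, hac⟩ := hai₀
    refine Function.ne_iff.mpr ⟨i₀, ?_⟩
    have : b i₀ = c := HasValueAt.evalAt_eq hP hac
    rwa [this]
  -- The relations `∑ aᵢ D^{(j)} xᵢ = 0` are specialised only in their coefficients: with `b = a(P)`
  -- constant, `D^{(j)} (∑ bᵢ xᵢ)` has value 0 at `P`.
  have hb : b ∈ contactSubmodule (X := X) h0 (ε (Fin.last n)) := by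
    rw [mem_contactSubmodule]
    refine mem_maximalIdeal_pow_of_hasseDerivative hP ht htP (le_max_left _ _) hreg
      (le_max_right _ _) _ fun j hj => ?_
    let x : Fin (n + 1) → X.LocalRing P := fun i =>
      (⟨_, hD i j (hj.trans_le (le_max_right _ _))⟩ : X.localSubalgebra P)
    have hx : ∀ i, X.toFunctionField P (x i) = hasseDerivative ht j (X.coord i) := fun _ => rfl
    have h1 : ∑ i, a' i * x i = 0 := by
      apply toFunctionField_injective
      rw [map_sum, map_zero, ← haD j (hr ▸ hj)]
      exact Finset.sum_congr rfl fun i _ => by rw [map_mul, ha', hx]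
    have h2 : evalAt hP (∑ i, b i • x i) = 0 := by
      rw [← map_zero (evalAt hP), ← h1, map_sum, map_sum]
      exact Finset.sum_congr rfl fun i _ => by rw [map_smul, map_mul, smul_eq_mul]
    have h3 : X.toFunctionField P (∑ i, b i • x i) =
        hasseDerivative ht j (X.toFunctionField P (linearGerm h0 b)) := by
      rw [toFunctionField_linearGerm, hasseDerivative_sum_smul, map_sum]
      exact Finset.sum_congr rfl fun i _ => by rw [map_smul, hx]
    rw [← h3, ← h2]
    exact hasValueAt_evalAt hP _
  have hbq : ∑ i, b i * P.1.rep i ^ q = 0 := by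
    have h1 : ∑ i, a' i * coordGerm h0 i ^ q = 0 := by
      apply toFunctionField_injective
      rw [map_sum, map_zero, ← haq]
      exact Finset.sum_congr rfl fun i _ => by rw [map_mul, map_pow, ha']; rfl
    have h2 := congrArg (evalAt hP) h1
    rw [map_sum, map_zero] at h2
    have h3 : ∀ i, evalAt hP (coordGerm h0 i) = P.1.rep i / P.1.rep 0 :=
      fun i => HasValueAt.evalAt_eq hP (hasValueAt_coord h0 i)
    have h4 : (∑ i, b i * P.1.rep i ^ q) / P.1.rep 0 ^ q = 0 := by
      rw [← h2, Finset.sum_div]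
      exact Finset.sum_congr rfl fun i _ => by
        rw [map_mul, map_pow, h3, div_pow, mul_div_assoc]
    exact (div_eq_zero_iff.mp h4).resolve_right (pow_ne_zero _ h0)
  -- Uniqueness of the osculating hyperplane identifies `b` with `H_P` up to a scalar.
  obtain ⟨s, hs⟩ := Submodule.exists_smul_eq_of_finrank_le_one
    (finrank_contactSubmodule_last_le_one h0 P.2.2) hb hb0
    ((rep_mem_contactSubmodule_iff h0 (intersectionMultiplicity_gaussMap P) _).mpr le_rfl)
  simp only [hs, Pi.smul_apply, smul_eq_mul, mul_assoc]
  rw [← Finset.mul_sum, hbq, mul_zero]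

end ProjectiveCurve

/-! ### The fibres of the Gauss map. -/

theorem mainTheorem3 {F k : Type*} [Field F] [Finite F] [Field k] [Algebra F k] [IsAlgClosure F k]
    {n : ℕ} (hn : 1 ≤ n) (X : ProjectiveCurve k n) (hX : X.IsDefinedOver F)
    (ε : Fin (n + 1) → ℕ) (hε : X.IsOrderSequence ε)
    (ν : Fin n → ℕ) (hν : X.IsFrobeniusOrderSequence (Nat.card F) ν)
    (hnonclassical : ν ≠ fun i : Fin n => (i : ℕ))
    (hlast : ν ⟨n - 1, Nat.sub_one_lt_of_lt hn⟩ = ε (Fin.last n))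
    (hdeg : n ≤ X.gaussSeparableDegree ε) :
    ∀ᶠ P : X.genericPoints ε in Filter.cofinite,
      ∃ W : Submodule k (Fin (n + 1) → k), Module.finrank k W = n - 1 ∧
        ∀ Q : X.genericPoints ε, X.gaussMap Q = X.gaussMap P → (Q : ℙ k _).submodule ≤ W := by
  have := IsAlgClosure.isAlgClosed F (K := k)
  have := Fintype.ofFinite F
  obtain ⟨p, hp, e, hpp, hcard⟩ := FiniteField.card' F
  rw [← Nat.card_eq_fintype_card] at hcard
  have := charP_of_injective_algebraMap (algebraMap F k).injective p
  have : ExpChar k p := ExpChar.prime hpp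
  have hfrob := ProjectiveCurve.eventually_sum_gaussMap_mul_pow_eq_zero hν hlast
  have h0 := ProjectiveCurve.eventually_genericPoints (ε := ε)
    X.eventually_rep_zero_ne_zero
  have hgood := hfrob.and h0
  -- Strict monotonicity of `ε`, hence `εₙ > 0`, is read off at a generic point.
  rcases isEmpty_or_nonempty (X.genericPoints ε) with hempty | ⟨⟨P₀⟩⟩
  · exact Filter.Eventually.of_forall fun P => hempty.elim P
  have hεn : ε (Fin.last n) ≠ 0 := by
    have := P₀.2.2.1 (show (0 : Fin (n + 1)) < Fin.last n from Fin.lt_def.mpr hn)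
    omega
  have hrat := finite_setOf_rational (k := k) (Finite.one_lt_card (α := F)) n
  rw [Filter.eventually_cofinite] at hgood
  -- Two finite sets of hyperplanes are avoided: the images of the exceptional points, so that every
  -- point of the fibre, and not just `P`, is good; and the rational hyperplanes.
  have havoid := (Filter.eventually_all_finite ((hgood.image X.gaussMap).union hrat)).mpr
    fun H _ => ProjectiveCurve.eventually_gaussMap_ne (X := X) hεn H
  filter_upwards [havoid] with P hP
  have hfibre : ∀ Q : X.genericPoints ε, X.gaussMap Q = X.gaussMap P →
      ∑ i, (X.gaussMap P).rep i * Q.1.rep i ^ Nat.card F = 0 ∧ Q.1.rep 0 ≠ 0 := by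
    intro Q hQ
    by_contra h
    rw [← hQ] at h
    exact hP _ (Or.inl ⟨Q, h, hQ⟩) rfl
  let S : Set (Fin (n + 1) → k) :=
    {v | ∃ Q : X.genericPoints ε, X.gaussMap Q = X.gaussMap P ∧ v = Q.1.rep}
  -- Vector space dimension `n - 1` is projective dimension `n - 2`. A span of dimension at least
  -- `n` would force `H_P` to be rational.
  have hS : Module.finrank k (Submodule.span k S) ≤ n - 1 := by
    by_contra hlt
    refine hP (X.gaussMap P) (Or.inr fun j hj i => ?_) rfl
    rw [hcard]
    refine div_pow_eq_of_le_finrank_span (S := S) (by omega) ?_ ?_ hj i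
    · rintro _ ⟨Q, hQ, rfl⟩
      rw [← hQ]
      exact ProjectiveCurve.sum_gaussMap_mul_eq_zero hεn Q (hfibre Q hQ).2
    · rintro _ ⟨Q, hQ, rfl⟩
      rw [← hcard]
      exact (hfibre Q hQ).1
  obtain ⟨W, hSW, hW⟩ := (Submodule.span k S).exists_ge_finrank_eq hS
    (by rw [Module.finrank_fin_fun]; omega)
  refine ⟨W, hW, fun Q hQ => ?_⟩
  rw [Projectivization.submodule_eq, Submodule.span_singleton_le_iff_mem]
  exact hSW (Submodule.subset_span ⟨Q, hQ, rfl⟩)
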